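/- For each $n\ge 1$ let $W^{(n)}$ be an $n\times n$ distance matrix (symmetric, nonnegative entries, zero diagonal) of $n$ spatial locations, and suppose that at these locations $$Y = Z\beta + U + \epsilon,\qquad \epsilon\sim\mathcal N(0,\sigma_\epsilon^2 I_n)\ \text{ independent of } (U,Z),\qquad \begin{pmatrix}U\\ Z\end{pmatrix}\sim\mathcal N\left(0,\begin{pmatrix}\Sigma_{UU}&\Sigma_{UZ}\\ \Sigma_{UZ}^{\mathsf T}&\Sigma_{ZZ}\end{pmatrix}\right),$$ where, for $1\le i,j\le n$, $$(\Sigma_{UU})_{ij}=\sigma_U^2\, C(\phi,\nu_U;W^{(n)}_{ij}),\quad (\Sigma_{ZZ})_{ij}=\sigma_Z^2\, C(\phi,\nu_Z;W^{(n)}_{ij}),\quad (\Sigma_{UZ})_{ij}=\rho\sigma_U\sigma_Z\, C\big(\phi,\tfrac{\nu_U+\nu_Z}{2};W^{(n)}_{ij}\big),$$ and $C(\phi,\nu;w)=\frac{2^{1-\nu}}{\Gamma(\nu)}(w/\phi)^\nu K_\nu(w/\phi)$ for $w>0$, $C(\phi,\nu;0)=1$, is the Matérn correlation function, $K_\nu$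 being the modified Bessel function of the second kind. The parameter $\theta=(\beta,\rho,\sigma_U,\sigma_Z,\phi,\nu_U,\nu_Z,\sigma_\epsilon^2)$ satisfies $\sigma_U,\sigma_Z,\phi,\nu_U,\nu_Z>0$ and $\sigma_\epsilon^2\ge 0$, and is such that the covariance matrix of $(U,Z)$ is positive definite; call such a $\theta$ admissible for $W^{(n)}$. Only $(Y,Z)$ is observed. Suppose that $\max_{1\le i,j\le n}W^{(n)}_{ij}\to\infty$ as $n\to\infty$, and that the true parameter $\theta$, admissible for every $W^{(n)}$, satisfies $\nu_U\ne\nu_Z$ and $\rho\ne0$. Then all the model parameters, including $\beta$, are identifiable as $n\to\infty$: for every $\theta'\neq\theta$ and all sufficiently large $n$ (depending on $\theta'$), if $\theta'$ is admissible for $W^{(n)}$, then the distributions of $(Y,Z)$ at the $n$ locations under $\theta'$ and under $\theta$ are different. In particular, no $\theta'\ne\theta$ admissible for every $W^{(n)}$ gives the same distribution of $(Y,Z)$ as $\theta$ for all $n$. Moreover, for every set $S\subseteq[0,\infty)$ that is unbounded above: (a) for distinct $(\phi_1,\nu_1),(\phi_2,\nu_2)\in(0,\infty)^2$ and $a_1,a_2\in\mathbb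 R$, one has $a_1C(\phi_1,\nu_1;w)+a_2C(\phi_2,\nu_2;w)=0$ for all $w\in S$ if and only if $a_1=a_2=0$; (b) for every $\phi>0$, mutually distinct $\nu_1,\nu_2,\nu_3>0$ and $a_1,a_2,a_3\in\mathbb R$, one has $a_1C(\phi,\nu_1;w)+a_2C(\phi,\nu_2;w)+a_3C(\phi,\nu_3;w)=0$ for all $w\in S$ if and only if $a_1=a_2=a_3=0$. -/

import Mathlib

open MeasureTheory ProbabilityTheory Filter

namespace SpatialConfounding

noncomputable section

/-- The modified Bessel function of the second kind of real order `ν`, at `x > 0`: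
`K_ν(x) = ∫₀^∞ exp(-x cosh t) cosh(ν t) dt`. Only arguments `x > 0` are used below. -/
def besselK (ν x : ℝ) : ℝ :=
  ∫ t in Set.Ioi (0 : ℝ), Real.exp (-x * Real.cosh t) * Real.cosh (ν * t)

/-- The Matérn correlation function `C(φ, ν; w)` for `φ > 0`, `ν > 0`, `w ≥ 0`. At `w = 0`, where
`K_ν` has a pole, it takes its limiting value `1`. -/
def matern (φ ν w : ℝ) : ℝ :=
  if w = 0 then 1
  else 2 ^ (1 - ν) / Real.Gamma ν * (w / φ) ^ ν * besselK ν (w / φ)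

/-- A family of functions `C ψ`, `ψ : Ψ`, is `K`-linearly independent with respect to `S` if for
any `K` distinct indices the only linear combination vanishing on `S` is the trivial one. -/
def KLinearlyIndependent {Ψ : Type*} (C : Ψ → ℝ → ℝ) (K : ℕ) (S : Set ℝ) : Prop :=
  ∀ ψ : Fin K → Ψ, Function.Injective ψ →
    ∀ c : Fin K → ℝ, (∀ w ∈ S, ∑ k, c k * C (ψ k) w = 0) ↔ ∀ k, c k = 0

/-- A distance matrix: symmetric, with nonnegative entries and zero diagonal. -/
structure IsDistanceMatrix {n : ℕ} (W : Matrix (Fin n) (Fin n) ℝ) : Prop where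
  symm : W.IsSymm
  nonneg : ∀ i j, 0 ≤ W i j
  diag : ∀ i, W i i = 0

/-- All parameters of the model. -/
@[ext]
structure Params where
  /-- treatment effect -/
  beta : ℝ
  /-- cross-correlation parameter of `U` and `Z` -/
  rho : ℝ
  /-- marginal standard deviation of `U` -/
  sigmaU : ℝ
  /-- marginal standard deviation of `Z` -/
  sigmaZ : ℝ
  /-- common range -/
  phi : ℝ
  /-- smoothness of `U` -/
  nuU : ℝ
  /-- smoothness of `Z` -/
  nuZ : ℝ
  /-- variance of the white noise -/
  sigmaEpsSq : ℝ

variable {n : ℕ}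

/-- The covariance matrix `Σ_UU`. -/
def covUU (W : Matrix (Fin n) (Fin n) ℝ) (θ : Params) : Matrix (Fin n) (Fin n) ℝ :=
  Matrix.of fun i j => θ.sigmaU ^ 2 * matern θ.phi θ.nuU (W i j)

/-- The covariance matrix `Σ_ZZ`. -/
def covZZ (W : Matrix (Fin n) (Fin n) ℝ) (θ : Params) : Matrix (Fin n) (Fin n) ℝ :=
  Matrix.of fun i j => θ.sigmaZ ^ 2 * matern θ.phi θ.nuZ (W i j)

/-- The cross-covariance matrix `Σ_UZ`, with the average of the two smoothness parameters. -/
def covUZ (W : Matrix (Fin n) (Fin n) ℝ) (θ : Params) : Matrix (Fin n) (Fin n) ℝ :=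
  Matrix.of fun i j =>
    θ.rho * θ.sigmaU * θ.sigmaZ * matern θ.phi ((θ.nuU + θ.nuZ) / 2) (W i j)

/-- The joint covariance matrix `Σ` of `(U, Z)`; the left summand indexes `U`, the right `Z`. -/
def jointCov (W : Matrix (Fin n) (Fin n) ℝ) (θ : Params) :
    Matrix (Fin n ⊕ Fin n) (Fin n ⊕ Fin n) ℝ :=
  Matrix.fromBlocks (covUU W θ) (covUZ W θ) (covUZ W θ).transpose (covZZ W θ)

/-- The parameter space of the model at locations with distance matrix `W`: the standard
deviations, range and smoothness parameters are positive, the noise variance is nonnegative, and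
the covariance matrix of `(U, Z)` is positive definite. -/
structure Admissible (W : Matrix (Fin n) (Fin n) ℝ) (θ : Params) : Prop where
  sigmaU_pos : 0 < θ.sigmaU
  sigmaZ_pos : 0 < θ.sigmaZ
  phi_pos : 0 < θ.phi
  nuU_pos : 0 < θ.nuU
  nuZ_pos : 0 < θ.nuZ
  sigmaEpsSq_nonneg : 0 ≤ θ.sigmaEpsSq
  posDef : (jointCov W θ).PosDef

/-- The distribution of the observed data `(Y, Z)`, where `(U, Z) ∼ N(0, Σ)`,
`ε ∼ N(0, σ_ε² I_n)` is independent of `(U, Z)`, and `Y = β Z + U + ε`. -/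
def obsLaw (W : Matrix (Fin n) (Fin n) ℝ) (θ : Params) :
    Measure (EuclideanSpace ℝ (Fin n) × EuclideanSpace ℝ (Fin n)) :=
  ((multivariateGaussian 0 (jointCov W θ)).prod
      (multivariateGaussian 0 (θ.sigmaEpsSq • (1 : Matrix (Fin n) (Fin n) ℝ)))).map
    fun p => (WithLp.toLp 2 fun i => θ.beta * p.1 (Sum.inr i) + p.1 (Sum.inl i) + p.2 i,
      WithLp.toLp 2 fun i => p.1 (Sum.inr i))

/-- Identifiability of all parameters at the true value `θ` as the number of locations grows, along
the distance matrices `W n`: every other parameter value `θ'` is, for all large `n`, ruled out by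
the distribution of the observed data at the `n` locations (it either lies outside the parameter
space or yields a different distribution). In particular, no `θ' ≠ θ` gives the same distribution
of the observed data for all `n`. -/
def AsymptoticallyIdentifiable (W : (n : ℕ) → Matrix (Fin n) (Fin n) ℝ) (θ : Params) : Prop :=
  ∀ θ' : Params, θ' ≠ θ →
    ∀ᶠ n in atTop, Admissible (W n) θ' → obsLaw (W n) θ' ≠ obsLaw (W n) θ

end

end SpatialConfounding

namespace SpatialConfounding

open Asymptotics Topology

section LinearIndependence

/-- Functions that are strictly ordered by `o(·)` along a filter and eventually nonzero are linearly
independent along that filter. -/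
theorem coeff_eq_zero_of_isLittleO {ι α Ψ : Type*} [Fintype ι] [LinearOrder Ψ] {l : Filter α}
    [l.NeBot] {f : ι → α → ℝ} {r : ι → Ψ} (hr : Function.Injective r)
    (ho : ∀ a b, r a < r b → f a =o[l] f b) (hne : ∀ a, ∀ᶠ w in l, f a w ≠ 0)
    {c : ι → ℝ} (hc : ∀ᶠ w in l, ∑ k, c k * f k w = 0) (k : ι) : c k = 0 := by
  classical
  by_contra hk
  obtain ⟨m, hm, hmax⟩ := Finset.exists_max_image (Finset.univ.filter fun k => c k ≠ 0) r
    ⟨k, by simpa using hk⟩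
  have hrest : (fun w => ∑ k ∈ Finset.univ.erase m, c k * f k w) =o[l] f m := by
    refine IsLittleO.fun_sum fun i hi => ?_
    by_cases hci : c i = 0
    · simp [hci]
    · refine (ho i m ?_).const_mul_left _
      exact lt_of_le_of_ne (hmax i (by simpa using hci)) (hr.ne (Finset.ne_of_mem_erase hi))
  have hself : (fun w => -c m * f m w) =o[l] f m := by
    refine hrest.congr' ?_ EventuallyEq.rfl
    filter_upwards [hc] with w hw
    rw [← Finset.add_sum_erase _ _ (Finset.mem_univ m)] at hw
    linarith
  have hm' : c m ≠ 0 := by simpa using hm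
  rw [isLittleO_const_mul_left_iff (neg_ne_zero.2 hm')] at hself
  exact isLittleO_irrefl (hne m).frequently hself

theorem injective_vec_two {α : Type*} {a b : α} (h : a ≠ b) : Function.Injective ![a, b] := by
  intro i j hij
  fin_cases i <;> fin_cases j <;> simp_all

theorem injective_vec_three {α : Type*} {a b c : α} (hab : a ≠ b) (hac : a ≠ c) (hbc : b ≠ c) :
    Function.Injective ![a, b, c] := by
  intro i j hij
  fin_cases i <;> fin_cases j <;> simp_all

end LinearIndependence

section Bessel

theorem one_add_sq_div_two_le_cosh (t : ℝ) : 1 + t ^ 2 / 2 ≤ Real.cosh t := by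
  have h := Real.cosh_sq (t / 2)
  have h2 := Real.cosh_two_mul (t / 2)
  rw [mul_div_cancel₀ _ two_ne_zero] at h2
  have h3 : (t / 2) ^ 2 ≤ Real.sinh (t / 2) ^ 2 := by
    rw [sq_le_sq, Real.abs_sinh]
    exact Real.self_le_sinh_iff.2 (abs_nonneg _)
  nlinarith

theorem besselK_integrableOn (ν : ℝ) {x : ℝ} (hx : 0 < x) :
    IntegrableOn (fun t => Real.exp (-x * Real.cosh t) * Real.cosh (ν * t)) (Set.Ioi 0) := by
  refine Integrable.integrableOn ?_
  have hg : Integrable fun t : ℝ => Real.exp (ν ^ 2 / x) * Real.exp (-(x / 4) * t ^ 2) :=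
    (integrable_exp_neg_mul_sq (by positivity)).const_mul _
  refine hg.mono' (by fun_prop) (ae_of_all _ fun t => ?_)
  have hcosh : Real.cosh (ν * t) ≤ Real.exp |ν * t| := by
    rw [← Real.cosh_abs, Real.cosh_eq]
    have : Real.exp (-|ν * t|) ≤ Real.exp |ν * t| :=
      Real.exp_le_exp.2 (by linarith [abs_nonneg (ν * t)])
    linarith
  rw [Real.norm_of_nonneg (mul_nonneg (Real.exp_pos _).le (Real.cosh_pos _).le)]
  refine (mul_le_mul_of_nonneg_left hcosh (Real.exp_pos _).le).trans ?_
  rw [← Real.exp_add, ← Real.exp_add, Real.exp_le_exp]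
  have h1 := mul_le_mul_of_nonneg_left (one_add_sq_div_two_le_cosh t) hx.le
  have h2 : |ν * t| ≤ ν ^ 2 / x + x / 4 * t ^ 2 := by
    have : 0 ≤ (|ν| / √x - √x / 2 * |t|) ^ 2 := sq_nonneg _
    have hs : √x ≠ 0 := (Real.sqrt_pos.2 hx).ne'
    have e : (|ν| / √x - √x / 2 * |t|) ^ 2 = |ν| ^ 2 / √x ^ 2 + √x ^ 2 / 4 * |t| ^ 2 - |ν| * |t| := by
      field_simp
      ring
    rw [e, Real.sq_sqrt hx.le, sq_abs, sq_abs] at this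
    rw [abs_mul]
    linarith
  nlinarith

theorem besselK_nonneg (ν x : ℝ) : 0 ≤ besselK ν x :=
  integral_nonneg fun _ => mul_nonneg (Real.exp_pos _).le (Real.cosh_pos _).le

theorem mul_exp_le_besselK (ν : ℝ) {x t : ℝ} (hx : 0 < x) (ht : 0 < t) :
    t * Real.exp (-(Real.cosh t * x)) ≤ besselK ν x := by
  have hI := besselK_integrableOn ν hx
  calc t * Real.exp (-(Real.cosh t * x))
      = ∫ _ in Set.Ioc 0 t, Real.exp (-(Real.cosh t * x)) := by
        simp [ht.le]
    _ ≤ ∫ s in Set.Ioc 0 t, Real.exp (-x * Real.cosh s) * Real.cosh (ν * s) := by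
        refine setIntegral_mono_on (by simp) (hI.mono_set Set.Ioc_subset_Ioi_self)
          measurableSet_Ioc fun s hs => ?_
        have h1 : Real.cosh s ≤ Real.cosh t := by
          rw [Real.cosh_le_cosh, abs_of_pos hs.1, abs_of_pos ht]
          exact hs.2
        calc Real.exp (-(Real.cosh t * x)) ≤ Real.exp (-x * Real.cosh s) :=
              Real.exp_le_exp.2 (by nlinarith)
          _ ≤ _ := le_mul_of_one_le_right (Real.exp_pos _).le (Real.one_le_cosh _)
    _ ≤ besselK ν x := setIntegral_mono_set hI
        (ae_of_all _ fun _ => mul_nonneg (Real.exp_pos _).le (Real.cosh_pos _).le)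
        (LE.le.eventuallyLE Set.Ioc_subset_Ioi_self)

theorem besselK_pos (ν : ℝ) {x : ℝ} (hx : 0 < x) : 0 < besselK ν x :=
  (by positivity : 0 < 1 * Real.exp (-(Real.cosh 1 * x))).trans_le
    (mul_exp_le_besselK ν hx one_pos)

theorem besselK_le_exp_mul (ν : ℝ) {x : ℝ} (hx : 1 ≤ x) :
    besselK ν x ≤ Real.exp (-(x - 1)) * besselK ν 1 := by
  rw [besselK, besselK, ← integral_const_mul]
  refine setIntegral_mono_on (besselK_integrableOn ν (by linarith))
    ((besselK_integrableOn ν one_pos).const_mul _) measurableSet_Ioi fun t _ => ?_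
  rw [← mul_assoc, ← Real.exp_add]
  refine mul_le_mul_of_nonneg_right (Real.exp_le_exp.2 ?_) (Real.cosh_pos _).le
  nlinarith [Real.one_le_cosh t]

theorem besselK_mono_order {ν₁ ν₂ x : ℝ} (h1 : 0 ≤ ν₁) (h : ν₁ ≤ ν₂) (hx : 0 < x) :
    besselK ν₁ x ≤ besselK ν₂ x := by
  refine setIntegral_mono_on (besselK_integrableOn _ hx) (besselK_integrableOn _ hx)
    measurableSet_Ioi fun t ht => mul_le_mul_of_nonneg_left ?_ (Real.exp_pos _).le
  have ht : 0 < t := ht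
  rw [Real.cosh_le_cosh, abs_of_nonneg (by positivity), abs_of_nonneg (mul_nonneg (h1.trans h) ht.le)]
  gcongr

end Bessel

section Matern

theorem matern_zero (φ ν : ℝ) : matern φ ν 0 = 1 := if_pos rfl

theorem matern_pos {φ ν w : ℝ} (hφ : 0 < φ) (hν : 0 < ν) (hw : 0 < w) : 0 < matern φ ν w := by
  rw [matern, if_neg hw.ne']
  have := Real.Gamma_pos_of_pos hν
  have := besselK_pos ν (div_pos hw hφ)
  positivity

theorem matern_isTheta {φ ν : ℝ} (hν : 0 < ν) :
    matern φ ν =Θ[atTop] fun w => (w / φ) ^ ν * besselK ν (w / φ) := by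
  have hc : (2 : ℝ) ^ (1 - ν) / Real.Gamma ν ≠ 0 :=
    (div_pos (by positivity) (Real.Gamma_pos_of_pos hν)).ne'
  have h : (fun w => (2 : ℝ) ^ (1 - ν) / Real.Gamma ν * ((w / φ) ^ ν * besselK ν (w / φ)))
      =Θ[atTop] fun w => (w / φ) ^ ν * besselK ν (w / φ) :=
    (isTheta_const_mul_left hc).2 (isTheta_refl _ _)
  refine (EventuallyEq.isTheta ?_).trans h
  filter_upwards [eventually_gt_atTop 0] with w hw
  rw [matern, if_neg hw.ne', mul_assoc]

theorem rpow_isLittleO_rpow {a b : ℝ} (h : a < b) :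
    (fun x : ℝ => x ^ a) =o[atTop] fun x => x ^ b := by
  refine (isLittleO_iff_tendsto' ?_).2 ?_
  · filter_upwards [eventually_gt_atTop 0] with x hx h0
    exact absurd h0 (Real.rpow_pos_of_pos hx b).ne'
  · refine (tendsto_rpow_neg_atTop (sub_pos.2 h)).congr' ?_
    filter_upwards [eventually_gt_atTop 0] with x hx
    rw [← Real.rpow_sub hx, neg_sub]

theorem matern_isLittleO_of_smoothness_lt {φ ν₁ ν₂ : ℝ} (hφ : 0 < φ) (h1 : 0 < ν₁) (h : ν₁ < ν₂) :
    matern φ ν₁ =o[atTop] matern φ ν₂ := by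
  refine (matern_isTheta h1).trans_isLittleO (IsLittleO.trans_isTheta ?_
    (matern_isTheta (h1.trans h)).symm)
  have hlim : Tendsto (fun w : ℝ => w / φ) atTop atTop := tendsto_id.atTop_div_const hφ
  refine ((rpow_isLittleO_rpow h).comp_tendsto hlim).mul_isBigO (IsBigO.of_bound 1 ?_)
  filter_upwards [eventually_gt_atTop 0] with w hw
  rw [one_mul, Real.norm_of_nonneg (besselK_nonneg _ _), Real.norm_of_nonneg (besselK_nonneg _ _)]
  exact besselK_mono_order h1.le h.le (div_pos hw hφ)

theorem matern_isLittleO_of_range_lt {φ₁ φ₂ ν₁ ν₂ : ℝ} (hφ₁ : 0 < φ₁) (hφ : φ₁ < φ₂)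
    (h1 : 0 < ν₁) (h2 : 0 < ν₂) : matern φ₁ ν₁ =o[atTop] matern φ₂ ν₂ := by
  have hφ₂ := hφ₁.trans hφ
  obtain ⟨t, ht, htφ⟩ : ∃ t > 0, Real.cosh t / φ₂ < 1 / φ₁ := by
    have hc : Tendsto (fun t => Real.cosh t / φ₂) (𝓝[>] 0) (𝓝 (Real.cosh 0 / φ₂)) :=
      ((Real.continuous_cosh.div_const φ₂).tendsto 0).mono_left nhdsWithin_le_nhds
    rw [Real.cosh_zero] at hc
    obtain ⟨t, h, ht⟩ := ((hc.eventually_lt_const (one_div_lt_one_div_of_lt hφ₁ hφ)).and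
      self_mem_nhdsWithin).exists
    exact ⟨t, ht, h⟩
  set δ := 1 / φ₁ - Real.cosh t / φ₂ with hδ
  have hδ0 : 0 < δ := sub_pos.2 htφ
  have hlim₁ : Tendsto (fun w : ℝ => w / φ₁) atTop atTop := tendsto_id.atTop_div_const hφ₁
  have hlim₂ : Tendsto (fun w : ℝ => w / φ₂) atTop atTop := tendsto_id.atTop_div_const hφ₂
  have hupper : matern φ₁ ν₁ =O[atTop] fun w => w ^ ν₁ * Real.exp (-(1 / φ₁) * w) := by
    refine (matern_isTheta h1).1.trans (IsBigO.mul ?_ (IsBigO.of_bound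
      (Real.exp 1 * besselK ν₁ 1) ?_))
    · refine IsBigO.of_bound ((1 / φ₁) ^ ν₁) ?_
      filter_upwards [eventually_gt_atTop 0] with w hw
      rw [Real.norm_of_nonneg (by positivity), Real.norm_of_nonneg (by positivity),
        ← Real.mul_rpow (by positivity) hw.le, one_div_mul_eq_div]
    · filter_upwards [hlim₁.eventually_ge_atTop 1] with w hw
      rw [Real.norm_of_nonneg (besselK_nonneg _ _), Real.norm_of_nonneg (Real.exp_pos _).le]
      refine (besselK_le_exp_mul ν₁ hw).trans_eq ?_
      rw [mul_right_comm, ← Real.exp_add]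
      congr 2
      ring
  have hlower : (fun w => Real.exp (-(Real.cosh t / φ₂) * w)) =O[atTop] matern φ₂ ν₂ := by
    refine IsBigO.trans (IsBigO.of_bound (1 / t) ?_) (matern_isTheta h2).2
    filter_upwards [hlim₂.eventually_ge_atTop 1] with w hw
    have hb := mul_exp_le_besselK ν₂ (zero_lt_one.trans_le hw) ht
    have hp := Real.one_le_rpow hw h2.le
    rw [Real.norm_of_nonneg (Real.exp_pos _).le, Real.norm_of_nonneg
      (mul_nonneg (zero_le_one.trans hp) (besselK_nonneg _ _)), one_div_mul_eq_div, le_div_iff₀ ht]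
    calc Real.exp (-(Real.cosh t / φ₂) * w) * t = t * Real.exp (-(Real.cosh t * (w / φ₂))) := by
          rw [mul_comm]; congr 2; ring
      _ ≤ besselK ν₂ (w / φ₂) := hb
      _ ≤ _ := le_mul_of_one_le_left (besselK_nonneg _ _) hp
  refine hupper.trans_isLittleO (IsLittleO.trans_isBigO ?_ hlower)
  refine ((isLittleO_rpow_exp_pos_mul_atTop ν₁ hδ0).mul_isBigO
    (isBigO_refl (fun w => Real.exp (-(1 / φ₁) * w)) atTop)).congr_right fun w => ?_
  rw [← Real.exp_add]
  congr 1
  rw [hδ]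
  ring

/-- Matérn functions with distinct parameters are linearly independent on any unbounded set. -/
theorem matern_kLinearlyIndependent (K : ℕ) {S : Set ℝ} (hS : ∀ L : ℝ, ∃ w ∈ S, L < w) :
    KLinearlyIndependent
      (fun (ψ : Set.Ioi (0 : ℝ) × Set.Ioi (0 : ℝ)) w => matern ψ.1 ψ.2 w) K S := by
  intro ψ hψ c
  refine ⟨fun h => ?_, fun h w _ => by simp [h]⟩
  have hne : (atTop ⊓ 𝓟 S : Filter ℝ).NeBot := by
    rw [← frequently_mem_iff_neBot, frequently_atTop]
    intro L
    obtain ⟨w, hw, hL⟩ := hS L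
    exact ⟨w, hL.le, hw⟩
  have hpos (k : Fin K) : 0 < ((ψ k).1 : ℝ) ∧ 0 < ((ψ k).2 : ℝ) := ⟨(ψ k).1.2, (ψ k).2.2⟩
  refine coeff_eq_zero_of_isLittleO (l := atTop ⊓ 𝓟 S) (f := fun k => matern (ψ k).1 (ψ k).2)
    (r := fun k => toLex (ψ k)) (toLex.injective.comp hψ) ?_ ?_ ?_
  · intro a b hab
    refine IsLittleO.mono ?_ inf_le_left
    rcases Prod.Lex.toLex_lt_toLex.1 hab with h1 | ⟨h1, h2⟩
    · exact matern_isLittleO_of_range_lt (hpos a).1 h1 (hpos a).2 (hpos b).2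
    · rw [h1]
      exact matern_isLittleO_of_smoothness_lt (hpos b).1 (hpos a).2 h2
  · intro a
    refine Eventually.filter_mono inf_le_left ?_
    filter_upwards [eventually_gt_atTop 0] with w hw
    exact (matern_pos (hpos a).1 (hpos a).2 hw).ne'
  · exact Eventually.filter_mono inf_le_right (by simpa [eventually_principal] using h)

theorem matern_kLinearlyIndependent_smoothness (K : ℕ) {S : Set ℝ}
    (hS : ∀ L : ℝ, ∃ w ∈ S, L < w) {φ : ℝ} (hφ : 0 < φ) :
    KLinearlyIndependent (fun (ν : Set.Ioi (0 : ℝ)) w => matern φ ν w) K S := fun ν hν c =>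
  matern_kLinearlyIndependent K hS (fun k => (⟨φ, hφ⟩, ν k))
    (fun _ _ h => hν (Prod.ext_iff.1 h).2) c

end Matern

section Covariance

variable {n : ℕ} {W : Matrix (Fin n) (Fin n) ℝ} {θ : Params}

theorem covariance_comp_fst_prod {Ω Ω' : Type*} [MeasurableSpace Ω] [MeasurableSpace Ω']
    {μ : Measure Ω} {ν : Measure Ω'} [SFinite μ] [IsProbabilityMeasure ν] {X Y : Ω → ℝ}
    (hX : AEStronglyMeasurable X μ) (hY : AEStronglyMeasurable Y μ) :
    cov[fun p => X p.1, fun p => Y p.1; μ.prod ν] = cov[X, Y; μ] := by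
  have hmap : (μ.prod ν).map Prod.fst = μ := by simp
  rw [← hmap] at hX hY
  conv_rhs => rw [← hmap]
  exact (covariance_map hX hY measurable_fst.aemeasurable).symm

theorem covariance_comp_snd_prod {Ω Ω' : Type*} [MeasurableSpace Ω] [MeasurableSpace Ω']
    {μ : Measure Ω} {ν : Measure Ω'} [IsProbabilityMeasure μ] [SFinite ν] {X Y : Ω' → ℝ}
    (hX : AEStronglyMeasurable X ν) (hY : AEStronglyMeasurable Y ν) :
    cov[fun p => X p.2, fun p => Y p.2; μ.prod ν] = cov[X, Y; ν] := by
  have hmap : (μ.prod ν).map Prod.snd = ν := by simp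
  rw [← hmap] at hX hY
  conv_rhs => rw [← hmap]
  exact (covariance_map hX hY measurable_snd.aemeasurable).symm

theorem memLp_two_eval_multivariateGaussian {ι : Type*} [Fintype ι] [DecidableEq ι]
    (m : EuclideanSpace ℝ ι) (S : Matrix ι ι ℝ) (i : ι) :
    MemLp (fun x : EuclideanSpace ℝ ι => x i) 2 (multivariateGaussian m S) :=
  (IsGaussian.memLp_two_id (μ := multivariateGaussian m S)).eval_piLp i

/-- The joint law of `(U, Z)` and `ε`. -/
noncomputable def latentLaw (W : Matrix (Fin n) (Fin n) ℝ) (θ : Params) :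
    Measure (EuclideanSpace ℝ (Fin n ⊕ Fin n) × EuclideanSpace ℝ (Fin n)) :=
  (multivariateGaussian 0 (jointCov W θ)).prod
    (multivariateGaussian 0 (θ.sigmaEpsSq • (1 : Matrix (Fin n) (Fin n) ℝ)))

instance : IsProbabilityMeasure (latentLaw W θ) := by
  unfold latentLaw; infer_instance

theorem memLp_latentLaw_fst (a : Fin n ⊕ Fin n) :
    MemLp (fun p => p.1 a) 2 (latentLaw W θ) :=
  (memLp_two_eval_multivariateGaussian 0 (jointCov W θ) a).comp_fst _

theorem memLp_latentLaw_snd (i : Fin n) : MemLp (fun p => p.2 i) 2 (latentLaw W θ) :=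
  (memLp_two_eval_multivariateGaussian 0 _ i).comp_snd _

theorem covariance_latentLaw_fst_fst (hθ : Admissible W θ) (a b : Fin n ⊕ Fin n) :
    cov[fun p => p.1 a, fun p => p.1 b; latentLaw W θ] = jointCov W θ a b := by
  exact (covariance_comp_fst_prod (memLp_two_eval_multivariateGaussian _ _ a).1
    (memLp_two_eval_multivariateGaussian _ _ b).1).trans
      (covariance_eval_multivariateGaussian hθ.posDef.posSemidef a b)

theorem covariance_latentLaw_snd_snd (hθ : Admissible W θ) (i j : Fin n) :
    cov[fun p => p.2 i, fun p => p.2 j; latentLaw W θ] =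
      θ.sigmaEpsSq * (1 : Matrix (Fin n) (Fin n) ℝ) i j := by
  exact (covariance_comp_snd_prod (memLp_two_eval_multivariateGaussian _ _ i).1
    (memLp_two_eval_multivariateGaussian _ _ j).1).trans
      (covariance_eval_multivariateGaussian
        (Matrix.PosSemidef.one.smul hθ.sigmaEpsSq_nonneg) i j)

theorem covariance_latentLaw_fst_snd (a : Fin n ⊕ Fin n) (j : Fin n) :
    cov[fun p => p.1 a, fun p => p.2 j; latentLaw W θ] = 0 :=
  covariance_fst_snd_prod (memLp_two_eval_multivariateGaussian 0 (jointCov W θ) a)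
    (memLp_two_eval_multivariateGaussian 0 _ j)

theorem covariance_obsLaw (X Y : EuclideanSpace ℝ (Fin n) × EuclideanSpace ℝ (Fin n) → ℝ)
    (hX : Measurable X) (hY : Measurable Y) :
    cov[X, Y; obsLaw W θ] =
      cov[fun p => X (WithLp.toLp 2 fun i => θ.beta * p.1 (Sum.inr i) + p.1 (Sum.inl i) + p.2 i,
          WithLp.toLp 2 fun i => p.1 (Sum.inr i)),
        fun p => Y (WithLp.toLp 2 fun i => θ.beta * p.1 (Sum.inr i) + p.1 (Sum.inl i) + p.2 i,
          WithLp.toLp 2 fun i => p.1 (Sum.inr i)); latentLaw W θ] :=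
  covariance_map hX.aestronglyMeasurable hY.aestronglyMeasurable
    (Measurable.aemeasurable (by fun_prop))

theorem covariance_obsLaw_snd_snd (hθ : Admissible W θ) (i j : Fin n) :
    cov[fun p => p.2 i, fun p => p.2 j; obsLaw W θ] = covZZ W θ i j := by
  rw [covariance_obsLaw _ _ (by fun_prop) (by fun_prop)]
  exact covariance_latentLaw_fst_fst hθ _ _

theorem covariance_latentLaw_response_left {X : _ → ℝ} (hX : MemLp X 2 (latentLaw W θ))
    (i : Fin n) :
    cov[fun p => θ.beta * p.1 (Sum.inr i) + p.1 (Sum.inl i) + p.2 i, X; latentLaw W θ] =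
      θ.beta * cov[fun p => p.1 (Sum.inr i), X; latentLaw W θ] +
        cov[fun p => p.1 (Sum.inl i), X; latentLaw W θ] + cov[fun p => p.2 i, X; latentLaw W θ] := by
  have h1 := (memLp_latentLaw_fst (W := W) (θ := θ) (Sum.inr i)).const_mul θ.beta
  have h2 := memLp_latentLaw_fst (W := W) (θ := θ) (Sum.inl i)
  rw [← covariance_const_mul_left, ← covariance_add_left h1 h2 hX,
    ← covariance_add_left (h1.add h2) (memLp_latentLaw_snd i) hX]
  rfl

theorem covariance_obsLaw_fst_snd (hθ : Admissible W θ) (i j : Fin n) :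
    cov[fun p => p.1 i, fun p => p.2 j; obsLaw W θ] =
      θ.beta * covZZ W θ i j + covUZ W θ i j := by
  rw [covariance_obsLaw _ _ (by fun_prop) (by fun_prop)]
  refine (covariance_latentLaw_response_left (memLp_latentLaw_fst (Sum.inr j)) i).trans ?_
  rw [covariance_latentLaw_fst_fst hθ, covariance_latentLaw_fst_fst hθ, covariance_comm,
    covariance_latentLaw_fst_snd]
  simp [jointCov]

theorem covariance_obsLaw_fst_fst (hθ : Admissible W θ) (i j : Fin n) :
    cov[fun p => p.1 i, fun p => p.1 j; obsLaw W θ] =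
      θ.beta ^ 2 * covZZ W θ i j + θ.beta * (covUZ W θ i j + covUZ W θ j i) + covUU W θ i j +
        θ.sigmaEpsSq * (1 : Matrix (Fin n) (Fin n) ℝ) i j := by
  rw [covariance_obsLaw _ _ (by fun_prop) (by fun_prop)]
  have hY := (((memLp_latentLaw_fst (W := W) (θ := θ) (Sum.inr j)).const_mul θ.beta).add
    (memLp_latentLaw_fst (Sum.inl j))).add (memLp_latentLaw_snd j)
  refine (covariance_latentLaw_response_left hY i).trans ?_
  have key {X : _ → ℝ} (hX : MemLp X 2 (latentLaw W θ)) :=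
    (covariance_comm X _).trans (covariance_latentLaw_response_left hX j)
  refine (congrArg₂ (· + ·) (congrArg₂ (· + ·) (congrArg (θ.beta * ·)
    (key (memLp_latentLaw_fst _))) (key (memLp_latentLaw_fst _)))
    (key (memLp_latentLaw_snd _))).trans ?_
  have hz (a : Fin n ⊕ Fin n) (k : Fin n) :
      cov[fun p => p.2 k, fun p => p.1 a; latentLaw W θ] = 0 := by
    rw [covariance_comm, covariance_latentLaw_fst_snd]
  simp only [covariance_latentLaw_fst_fst hθ, covariance_latentLaw_snd_snd hθ,
    covariance_latentLaw_fst_snd, hz]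
  rw [← hθ.posDef.isHermitian.apply (Sum.inr j) (Sum.inr i),
    ← hθ.posDef.isHermitian.apply (Sum.inl j) (Sum.inl i), Matrix.one_apply, Matrix.one_apply]
  simp only [jointCov, Matrix.fromBlocks_apply₁₁, Matrix.fromBlocks_apply₁₂,
    Matrix.fromBlocks_apply₂₁, Matrix.fromBlocks_apply₂₂, Matrix.transpose_apply, star_trivial,
    eq_comm (a := j)]
  ring

end Covariance

section Identifiability

theorem exists_lt_entry_of_lt_iSup {n : ℕ} {W : Matrix (Fin n) (Fin n) ℝ} {L : ℝ} (hL : 0 ≤ L)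
    (h : L < ⨆ i, ⨆ j, W i j) : ∃ i j, L < W i j := by
  by_contra! hc
  exact h.not_ge (Real.iSup_le (fun i => Real.iSup_le (hc i) hL) hL)

/-- If the covariances of the observed data under `θ'` and `θ` agree at the distance `0` and at an
unbounded set `S` of positive distances, then `θ' = θ`. -/
theorem params_eq_of_covariance_eq {θ θ' : Params}
    (hU : 0 < θ.sigmaU) (hZ : 0 < θ.sigmaZ) (hφ : 0 < θ.phi) (hνU : 0 < θ.nuU) (hνZ : 0 < θ.nuZ)
    (hU' : 0 < θ'.sigmaU) (hZ' : 0 < θ'.sigmaZ) (hφ' : 0 < θ'.phi) (hνU' : 0 < θ'.nuU)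
    (hνZ' : 0 < θ'.nuZ) (hν : θ.nuU ≠ θ.nuZ) (hρ : θ.rho ≠ 0) {S : Set ℝ}
    (hSpos : ∀ w ∈ S, 0 < w) (hS : ∀ L : ℝ, ∃ w ∈ S, L < w)
    (hZ0 : θ'.sigmaZ ^ 2 = θ.sigmaZ ^ 2)
    (hZZ : ∀ w ∈ S, θ'.sigmaZ ^ 2 * matern θ'.phi θ'.nuZ w =
      θ.sigmaZ ^ 2 * matern θ.phi θ.nuZ w)
    (hYZ : ∀ w ∈ S, θ'.beta * (θ'.sigmaZ ^ 2 * matern θ'.phi θ'.nuZ w) +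
        θ'.rho * θ'.sigmaU * θ'.sigmaZ * matern θ'.phi ((θ'.nuU + θ'.nuZ) / 2) w =
      θ.beta * (θ.sigmaZ ^ 2 * matern θ.phi θ.nuZ w) +
        θ.rho * θ.sigmaU * θ.sigmaZ * matern θ.phi ((θ.nuU + θ.nuZ) / 2) w)
    (hYY : ∀ w ∈ S, θ'.beta ^ 2 * (θ'.sigmaZ ^ 2 * matern θ'.phi θ'.nuZ w) + θ'.beta *
        (2 * (θ'.rho * θ'.sigmaU * θ'.sigmaZ * matern θ'.phi ((θ'.nuU + θ'.nuZ) / 2) w)) +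
        θ'.sigmaU ^ 2 * matern θ'.phi θ'.nuU w =
      θ.beta ^ 2 * (θ.sigmaZ ^ 2 * matern θ.phi θ.nuZ w) + θ.beta *
        (2 * (θ.rho * θ.sigmaU * θ.sigmaZ * matern θ.phi ((θ.nuU + θ.nuZ) / 2) w)) +
        θ.sigmaU ^ 2 * matern θ.phi θ.nuU w)
    (hY0 : θ'.beta ^ 2 * θ'.sigmaZ ^ 2 + θ'.beta * (2 * (θ'.rho * θ'.sigmaU * θ'.sigmaZ)) +
        θ'.sigmaU ^ 2 + θ'.sigmaEpsSq =
      θ.beta ^ 2 * θ.sigmaZ ^ 2 + θ.beta * (2 * (θ.rho * θ.sigmaU * θ.sigmaZ)) +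
        θ.sigmaU ^ 2 + θ.sigmaEpsSq) : θ' = θ := by
  obtain ⟨β, ρ, sU, sZ, φ, νU, νZ, ε⟩ := θ
  obtain ⟨β', ρ', sU', sZ', φ', νU', νZ', ε'⟩ := θ'
  dsimp only at *
  obtain rfl : sZ' = sZ := (pow_left_inj₀ hZ'.le hZ.le two_ne_zero).1 hZ0
  have hsq : sZ' ^ 2 ≠ 0 := by positivity
  obtain ⟨rfl, rfl⟩ : φ' = φ ∧ νZ' = νZ := by
    by_contra hne
    have hinj : Function.Injective
        ![((⟨φ', hφ'⟩, ⟨νZ', hνZ'⟩) : Set.Ioi (0 : ℝ) × Set.Ioi (0 : ℝ)), (⟨φ, hφ⟩, ⟨νZ, hνZ⟩)] :=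
      injective_vec_two fun h =>
        hne ⟨congrArg (fun p => (p.1 : ℝ)) h, congrArg (fun p => (p.2 : ℝ)) h⟩
    have := (matern_kLinearlyIndependent 2 hS _ hinj ![1, -1]).1 fun w hw => by
      have := mul_left_cancel₀ hsq (hZZ w hw)
      simp [Fin.sum_univ_two, this]
    simpa using this 0
  have hc : ρ * sU * sZ' ≠ 0 := by positivity
  have hm : (νU + νZ') / 2 ≠ νZ' := fun h => hν (by linarith)
  have hm0 : 0 < (νU + νZ') / 2 := by positivity
  have hm0' : 0 < (νU' + νZ') / 2 := by positivity
  have pair {a b : ℝ} (h : ∀ w ∈ S, a * matern φ' νZ' w + b * matern φ' ((νU + νZ') / 2) w = 0) :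
      a = 0 ∧ b = 0 := by
    have hinj : Function.Injective
        ![(⟨νZ', hνZ⟩ : Set.Ioi (0 : ℝ)), ⟨(νU + νZ') / 2, hm0⟩] :=
      injective_vec_two fun h => hm (congrArg Subtype.val h).symm
    have := (matern_kLinearlyIndependent_smoothness 2 hS hφ _ hinj ![a, b]).1 fun w hw => by
      simpa [Fin.sum_univ_two] using h w hw
    exact ⟨by simpa using this 0, by simpa using this 1⟩
  obtain rfl : νU' = νU := by
    by_contra hUU
    by_cases hUZ : νU' = νZ'
    · subst hUZ
      refine hc (pair (a := β * sZ' ^ 2 - β' * sZ' ^ 2 - ρ' * sU' * sZ') fun w hw => ?_).2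
      have := hYZ w hw
      rw [add_self_div_two] at this
      linarith
    · have hinj : Function.Injective ![(⟨νZ', hνZ⟩ : Set.Ioi (0 : ℝ)),
          ⟨(νU + νZ') / 2, hm0⟩, ⟨(νU' + νZ') / 2, hm0'⟩] := by
        refine injective_vec_three (fun h => hm (congrArg Subtype.val h).symm) (fun h => ?_)
          fun h => ?_ <;> replace h := congrArg Subtype.val h <;> dsimp only at h
        · exact hUZ (by linarith)
        · exact hUU (by linarith)
      have := (matern_kLinearlyIndependent_smoothness 3 hS hφ _ hinj
        ![(β - β') * sZ' ^ 2, ρ * sU * sZ', -(ρ' * sU' * sZ')]).1 fun w hw => by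
          simp [Fin.sum_univ_three]
          linarith [hYZ w hw]
      exact hc (by simpa using this 1)
  obtain ⟨hβ, hρU⟩ := pair (a := (β' - β) * sZ' ^ 2) (b := (ρ' * sU' - ρ * sU) * sZ')
    fun w hw => by linarith [hYZ w hw]
  obtain rfl : β' = β := by simpa [sub_eq_zero, hZ.ne'] using hβ
  have hρU' : ρ' * sU' = ρ * sU := by simpa [sub_eq_zero, hZ.ne'] using hρU
  obtain ⟨w, hw, -⟩ := hS 0
  obtain rfl : sU' = sU := by
    have := hYY w hw
    rw [hρU', add_right_inj] at this
    exact (pow_left_inj₀ hU'.le hU.le two_ne_zero).1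
      (mul_right_cancel₀ (matern_pos hφ hνU (hSpos w hw)).ne' this)
  obtain rfl : ρ' = ρ := mul_right_cancel₀ hU.ne' hρU'
  obtain rfl : ε' = ε := by linarith
  rfl

theorem asymptoticallyIdentifiable {W : (n : ℕ) → Matrix (Fin n) (Fin n) ℝ}
    (hW : ∀ n, IsDistanceMatrix (W n))
    (hlim : Tendsto (fun n => ⨆ i, ⨆ j, W n i j) atTop atTop) {θ : Params}
    (hθ : ∀ n, Admissible (W n) θ) (hν : θ.nuU ≠ θ.nuZ) (hρ : θ.rho ≠ 0) :
    AsymptoticallyIdentifiable W θ := by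
  intro θ' hne
  by_contra hcon
  have hfreq : ∃ᶠ n in atTop, Admissible (W n) θ' ∧ obsLaw (W n) θ' = obsLaw (W n) θ := by
    simpa [Filter.Frequently] using hcon
  have hentry (L : ℝ) : ∃ n, (Admissible (W n) θ' ∧ obsLaw (W n) θ' = obsLaw (W n) θ) ∧
      ∃ i j, max L 0 < W n i j := by
    obtain ⟨n, hn, hL⟩ := (hfreq.and_eventually (hlim.eventually_gt_atTop (max L 0))).exists
    exact ⟨n, hn, exists_lt_entry_of_lt_iSup (le_max_right _ _) hL⟩
  obtain ⟨m, ⟨hadm, hlaw⟩, i₀, -⟩ := hentry 0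
  have hθm := hθ m
  let S : Set ℝ := {w | 0 < w ∧ ∃ n, (Admissible (W n) θ' ∧ obsLaw (W n) θ' = obsLaw (W n) θ) ∧
    ∃ i j, W n i j = w}
  have hS (L : ℝ) : ∃ w ∈ S, L < w := by
    obtain ⟨n, hn, i, j, h⟩ := hentry L
    exact ⟨W n i j, ⟨(le_max_right _ _).trans_lt h, n, hn, i, j, rfl⟩, (le_max_left _ _).trans_lt h⟩
  refine hne (params_eq_of_covariance_eq hθm.sigmaU_pos hθm.sigmaZ_pos hθm.phi_pos hθm.nuU_pos
    hθm.nuZ_pos hadm.sigmaU_pos hadm.sigmaZ_pos hadm.phi_pos hadm.nuU_pos hadm.nuZ_pos hν hρ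
    (S := S) (fun w hw => hw.1) hS ?_ ?_ ?_ ?_ ?_)
  · have h := covariance_obsLaw_snd_snd hadm i₀ i₀
    rw [hlaw, covariance_obsLaw_snd_snd hθm] at h
    simpa [covZZ, (hW m).diag, matern_zero] using h.symm
  · rintro w ⟨-, n, ⟨ha, hl⟩, i, j, rfl⟩
    have h := covariance_obsLaw_snd_snd ha i j
    rw [hl, covariance_obsLaw_snd_snd (hθ n)] at h
    exact h.symm
  · rintro w ⟨-, n, ⟨ha, hl⟩, i, j, rfl⟩
    have h := covariance_obsLaw_fst_snd ha i j
    rw [hl, covariance_obsLaw_fst_snd (hθ n)] at h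
    exact h.symm
  · rintro w ⟨hw, n, ⟨ha, hl⟩, i, j, rfl⟩
    have hij : i ≠ j := by
      rintro rfl
      exact hw.ne' ((hW n).diag i)
    have h := covariance_obsLaw_fst_fst ha i j
    rw [hl, covariance_obsLaw_fst_fst (hθ n)] at h
    simpa [covZZ, covUZ, covUU, hij, (hW n).symm.apply i j, ← two_mul] using h.symm
  · have h := covariance_obsLaw_fst_fst hadm i₀ i₀
    rw [hlaw, covariance_obsLaw_fst_fst hθm] at h
    simpa [covZZ, covUZ, covUU, (hW m).diag, matern_zero, ← two_mul] using h.symm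

end Identifiability

end SpatialConfounding

theorem theorem6 :
    -- identifiability of all the parameters
    (∀ W : (n : ℕ) → Matrix (Fin n) (Fin n) ℝ,
      (∀ n, SpatialConfounding.IsDistanceMatrix (W n)) →
      Filter.Tendsto (fun n => ⨆ i, ⨆ j, W n i j) Filter.atTop Filter.atTop →
      ∀ θ : SpatialConfounding.Params,
        (∀ n, SpatialConfounding.Admissible (W n) θ) →
        θ.nuU ≠ θ.nuZ → θ.rho ≠ 0 →
        SpatialConfounding.AsymptoticallyIdentifiable W θ) ∧
    -- linear independence of Matérn functions on every unbounded set of distances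
    (∀ S : Set ℝ, (∀ w ∈ S, 0 ≤ w) → (∀ L : ℝ, ∃ w ∈ S, L < w) →
      SpatialConfounding.KLinearlyIndependent
        (fun (ψ : Set.Ioi (0 : ℝ) × Set.Ioi (0 : ℝ)) w =>
          SpatialConfounding.matern ψ.1 ψ.2 w) 2 S ∧
      ∀ φ : ℝ, 0 < φ →
        SpatialConfounding.KLinearlyIndependent
          (fun (ν : Set.Ioi (0 : ℝ)) w => SpatialConfounding.matern φ ν w) 3 S) := by
  exact ⟨fun W hW hlim θ hθ hν hρ =>
      SpatialConfounding.asymptoticallyIdentifiable hW hlim hθ hν hρ,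
    fun S _ hS => ⟨SpatialConfounding.matern_kLinearlyIndependent 2 hS,
      fun φ hφ => SpatialConfounding.matern_kLinearlyIndependent_smoothness 3 hS hφ⟩⟩
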